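/- Let $k$ be a field and let $H$ be a finite simple hypergraph with vertex set $V=\{x_1,\dots,x_n\}$, that is, every edge is a subset of $V$ with at least two elements and no edge is contained in another edge. Identify the vertices with the variables of $R=k[x_1,\dots,x_n]$. A vertex cover of $H$ is a set $W\subseteq V$ that meets every edge, and the cover ideal of $H$ is $$J=J(H)=\Big(\prod_{x\in W}x \;\Big|\; W \text{ is a vertex cover of } H\Big)\subseteq R.$$ For $s\ge 1$, the $s$-th expansion $H^s$ is the hypergraph with vertex set $\{x_{i,j} : 1\le i\le n,\ 1\le j\le s\}$ (the $x_{i,j}$ are called the shadows of $x_i$) whose edges are all sets $\{x_{i_1,l_1},\dots,x_{i_r,l_r}\}$ where $\{x_{i_1},\dots,x_{i_r}\}$ is an edge of $H$ with $r$ elements and $1\le l_1,\dots,l_r\le s$, together with all pairs $\{x_{i,l},x_{i,k}\}$ with $l\neq k$. For a set $T$ of vertices of $H^s$, let $H^s_T$ be the induced subhypergraph, with vertex set $T$ and with those edges of $H^s$ that are contained in $T$. A $d$-coloring of a hypergraph is a partition of its vertex set into $d$ disjoint (possibly empty) classes none of which contains an edge; the chromatic number $\chi$ is the least $d$ for which a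 $d$-coloring exists. A hypergraph is critically $d$-chromatic if $\chi=d$ and removing any one vertex, together with all edges containing it, gives a hypergraph with chromatic number less than $d$. Then, for every $s\ge 1$ and every set of variables $\{x_{i_1},\dots,x_{i_r}\}\subseteq V$, the prime ideal $(x_{i_1},\dots,x_{i_r})$ is an associated prime of the $R$-module $R/J^s$ if and only if there is a set $T$ with $$\{x_{i_1,1},\dots,x_{i_r,1}\}\subseteq T\subseteq\{x_{i_1,1},\dots,x_{i_1,s},\dots,x_{i_r,1},\dots,x_{i_r,s}\}$$ such that $H^s_T$ is critically $(s+1)$-chromatic. -/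

import Mathlib

namespace Hypergraph

variable {α : Type*}

/-- A hypergraph is simple if every edge has at least two vertices and no edge is contained in
another edge. -/
def IsSimple (H : Hypergraph α) : Prop :=
  (∀ e ∈ H.edgeSet, 2 ≤ e.encard) ∧ IsAntichain (· ⊆ ·) H.edgeSet

/-- The induced subhypergraph on `W` (for `W ⊆ V(H)` its vertex set is `W`): its edges are the
edges of `H` contained in `W`. -/
def induce (H : Hypergraph α) (W : Set α) : Hypergraph α where
  vertexSet := H.vertexSet ∩ W
  edgeSet := {e | e ∈ H.edgeSet ∧ e ⊆ W}
  subset_vertexSet_of_mem_edgeSet' := fun _ he =>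
    Set.subset_inter (H.subset_vertexSet_of_mem_edgeSet' he.1) he.2

/-- The hypergraph `H ∖ {x}`, with `x` and all edges containing `x` removed. -/
def deleteVertex (H : Hypergraph α) (x : α) : Hypergraph α where
  vertexSet := H.vertexSet \ {x}
  edgeSet := {e | e ∈ H.edgeSet ∧ x ∉ e}
  subset_vertexSet_of_mem_edgeSet' := fun _ he =>
    Set.subset_sdiff_singleton (H.subset_vertexSet_of_mem_edgeSet' he.1) he.2

/-- A `d`-coloring: a partition of the vertex set into `d` disjoint (possibly empty) color classes,
none of which contains an edge. -/
structure IsColoring (H : Hypergraph α) {d : ℕ} (C : Fin d → Set α) : Prop where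
  iUnion_eq : ⋃ i, C i = H.vertexSet
  disjoint : Pairwise fun i j => Disjoint (C i) (C j)
  not_subset : ∀ e ∈ H.edgeSet, ∀ i, ¬ e ⊆ C i

/-- `H` has a `d`-coloring. -/
def Colorable (H : Hypergraph α) (d : ℕ) : Prop :=
  ∃ C : Fin d → Set α, H.IsColoring C

/-- The chromatic number: the least `d` such that `H` has a `d`-coloring (and `⊤` if there is no
such `d`). -/
noncomputable def chromaticNumber (H : Hypergraph α) : ℕ∞ :=
  ⨅ d ∈ {d : ℕ | H.Colorable d}, (d : ℕ∞)

/-- `H` is critically `d`-chromatic: its chromatic number is `d`, and removing any vertex gives a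
hypergraph of smaller chromatic number. -/
def IsCriticallyChromatic (H : Hypergraph α) (d : ℕ) : Prop :=
  H.chromaticNumber = d ∧ ∀ x ∈ H.vertexSet, (H.deleteVertex x).chromaticNumber < d

/-- The `s`-th expansion of `H`. The shadows of the vertex `i` are the pairs `(i, j)`, `j : Fin s`
(so `j = 0` is the first shadow). The edges are all the sets obtained from an edge of `H` by
replacing each of its vertices by one of its shadows, and all pairs of distinct shadows of one
vertex. -/
def expansion (H : Hypergraph α) (s : ℕ) : Hypergraph (α × Fin s) where
  vertexSet := {p | p.1 ∈ H.vertexSet}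
  edgeSet :=
    {F | ∃ e ∈ H.edgeSet, ∃ l : α → Fin s, F = (fun i => (i, l i)) '' e} ∪
    {F | ∃ i ∈ H.vertexSet, ∃ l k : Fin s, l ≠ k ∧ F = {(i, l), (i, k)}}
  subset_vertexSet_of_mem_edgeSet' := by
    rintro F (⟨e, he, l, rfl⟩ | ⟨i, hi, l, k, -, rfl⟩)
    · rintro _ ⟨i, hi, rfl⟩
      exact H.subset_vertexSet_of_mem_edgeSet' he hi
    · rintro p (rfl | rfl) <;> exact hi

/-- A vertex cover is a set of vertices that meets every edge. -/
def IsVertexCover (H : Hypergraph α) (W : Set α) : Prop :=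
  W ⊆ H.vertexSet ∧ ∀ e ∈ H.edgeSet, (W ∩ e).Nonempty

/-- The cover ideal: the ideal generated by the monomials `∏ i ∈ W, X i`, where `W` is a vertex
cover of `H`. -/
noncomputable def coverIdeal (K : Type*) [Field K] (H : Hypergraph α) :
    Ideal (MvPolynomial α K) :=
  Ideal.span {m | ∃ W : Finset α, H.IsVertexCover (W : Set α) ∧ m = ∏ i ∈ W, MvPolynomial.X i}

end Hypergraph

/-!
Both sides of the equivalence are statements about families of `s` independent sets of `H`, where a
set of vertices is independent if it contains no edge.

On the algebraic side, a monomial `x ^ a` lies in `J ^ s` if and only if it is divisible by a product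
of `s` squarefree monomials of vertex covers. The complements of these covers are `s` independent
sets, and the divisibility says that each vertex `i` lies in at least `s - a i` of them, with
truncated subtraction (`Hypergraph.hasIndepFamily_iff_exists_cover`). On the combinatorial side, a
color class of `H^s_T` contains at most one shadow of each vertex, and its projection to `H` is
independent; hence `H^s_T` is `s`-colorable if and only if there are `s` independent sets such that
each vertex `i` lies in at least as many of them as it has shadows in `T`
(`Hypergraph.colorable_induce_expansion_iff`). So `x ^ a` corresponds to the sets `T` having
`s - a i` shadows of each vertex `i`.

Since `J ^ s` is a monomial ideal, the prime generated by the variables in `P` is associated to it if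
and only if it is the annihilator of a monomial `x ^ a`
(`Hypergraph.span_X_image_mem_associatedPrimes_iff`). This means that `x ^ a` stays outside `J ^ s`
when multiplied by any monomial in the variables outside `P`, but is moved into it by each variable
in `P`. The first condition says that `T` is not `s`-colorable even after removing all shadows of the
vertices outside `P`, the second that removing one shadow of a vertex in `P` makes it `s`-colorable.
Together they say that the part of `T` over `P` is critically `(s + 1)`-chromatic, as a deleted
vertex can always be given a new color (`Hypergraph.isCriticallyChromatic_succ_iff`).
-/

open MvPolynomial

namespace Hypergraph

/-! ### Monomial ideals -/

section MonomialIdeal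

variable {σ K : Type*} [Field K]

/-- The substitution killing the variables in `P` and fixing the others identifies the ideal
generated by the variables in `P` with the kernel of a map to a domain. -/
theorem isPrime_span_X_image (P : Set σ) :
    (Ideal.span ((X : σ → MvPolynomial σ K) '' P)).IsPrime := by
  classical
  set I := Ideal.span ((X : σ → MvPolynomial σ K) '' P) with hI
  let φ : MvPolynomial σ K →ₐ[K] MvPolynomial σ K := aeval fun i => if i ∈ P then 0 else X i
  have hφ : (Ideal.Quotient.mkₐ K I).comp φ = Ideal.Quotient.mkₐ K I := by
    ext i
    by_cases hi : i ∈ P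
    · have : (Ideal.Quotient.mk I) (X i) = 0 :=
        Ideal.Quotient.eq_zero_iff_mem.2 (Ideal.subset_span ⟨i, hi, rfl⟩)
      simp [φ, hi, this]
    · simp [φ, hi]
  have hker : I = RingHom.ker φ := by
    refine le_antisymm (Ideal.span_le.2 ?_) fun f hf => ?_
    · rintro _ ⟨i, hi, rfl⟩
      simp [φ, hi]
    · have := DFunLike.congr_fun hφ f
      rw [AlgHom.comp_apply, (RingHom.mem_ker).1 hf, map_zero] at this
      exact Ideal.Quotient.eq_zero_iff_mem.1 this.symm
  rw [hker]
  exact RingHom.ker_isPrime φ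

/-- A power of a monomial ideal is generated by the products of the generating monomials. -/
theorem span_monomial_pow (S : Set (σ →₀ ℕ)) (n : ℕ) :
    Ideal.span ((fun a => monomial a (1 : K)) '' S) ^ n =
      Ideal.span ((fun a => monomial a (1 : K)) ''
        {a | ∃ f : Fin n → σ →₀ ℕ, (∀ j, f j ∈ S) ∧ a = ∑ j, f j}) := by
  rw [Ideal.span, Submodule.span_pow, Ideal.span]
  congr 1
  ext p
  rw [Set.mem_pow]
  constructor
  · rintro ⟨f, rfl⟩
    choose g hg hgf using fun j => (f j).2
    refine ⟨∑ j, g j, ⟨g, hg, rfl⟩, ?_⟩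
    rw [List.prod_ofFn]
    exact (monomial_sum_one _ _).trans (Finset.prod_congr rfl fun j _ => hgf j)
  · rintro ⟨_, ⟨g, hg, rfl⟩, rfl⟩
    refine ⟨fun j => ⟨monomial (g j) 1, g j, hg j, rfl⟩, ?_⟩
    rw [List.prod_ofFn]
    exact (monomial_sum_one _ _).symm

/-- An ideal generated by variables that is associated to a monomial ideal is the annihilator of a
monomial `x ^ a`. The exponent `a` is one of the exponents of an arbitrary polynomial with that
annihilator: if each of them could be moved into the ideal by a monomial in the variables outside
`P`, then the product of these monomials would annihilate the polynomial. -/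
theorem span_X_image_mem_associatedPrimes_iff [Finite σ] (S : Set (σ →₀ ℕ)) (P : Set σ) :
    Ideal.span ((X : σ → MvPolynomial σ K) '' P) ∈ associatedPrimes (MvPolynomial σ K)
        (MvPolynomial σ K ⧸ Ideal.span ((fun a => monomial a (1 : K)) '' S)) ↔
      ∃ a : σ →₀ ℕ, (∀ i ∈ P, ∃ g ∈ S, g ≤ a + Finsupp.single i 1) ∧
        ∀ b : σ →₀ ℕ, (∀ i ∈ P, b i = 0) → ¬ ∃ g ∈ S, g ≤ a + b := by
  classical
  rw [AssociatedPrimes.mem_iff, IsAssociatedPrime, Submodule.isAssociatedPrime_iff,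
    and_iff_right (isPrime_span_X_image P)]
  set I := Ideal.span ((fun a => monomial a (1 : K)) '' S) with hI
  have hcolon (f g : MvPolynomial σ K) :
      g ∈ (⊥ : Submodule (MvPolynomial σ K) (MvPolynomial σ K ⧸ I)).colon
        {Ideal.Quotient.mk I f} ↔ g * f ∈ I := by
    rw [Submodule.mem_colon_singleton, Submodule.mem_bot, ← Ideal.Quotient.eq_zero_iff_mem,
      map_mul]
    rfl
  constructor
  · rintro ⟨x, hx⟩
    obtain ⟨f, rfl⟩ := Ideal.Quotient.mk_surjective x
    have hmem (g) : g ∈ Ideal.span ((X : σ → MvPolynomial σ K) '' P) ↔ g * f ∈ I := by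
      rw [hx, hcolon]
    have key : ∃ a ∈ f.support, ∀ b : σ →₀ ℕ, (∀ i ∈ P, b i = 0) → ¬ ∃ g ∈ S, g ≤ a + b := by
      by_contra! h
      choose! b hb g hg hgb using h
      have h1 : monomial (∑ a ∈ f.support, b a) (1 : K) * f ∈ I := by
        rw [hI, mem_ideal_span_monomial_image]
        intro m hm
        rw [mem_support_iff, coeff_monomial_mul'] at hm
        split_ifs at hm with hle
        · have ha : m - ∑ a ∈ f.support, b a ∈ f.support := by simpa using hm
          refine ⟨_, hg _ ha, (hgb _ ha).trans ?_⟩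
          calc _ ≤ m - ∑ a ∈ f.support, b a + ∑ a ∈ f.support, b a := by
                gcongr
                exact Finset.single_le_sum (f := b) (fun _ _ => zero_le) ha
            _ = m := tsub_add_cancel_of_le hle
        · exact absurd rfl hm
      rw [← hmem, mem_ideal_span_X_image] at h1
      obtain ⟨i, hi, hne⟩ := h1 (∑ a ∈ f.support, b a) (by simp)
      refine hne ?_
      rw [Finsupp.finsetSum_apply]
      exact Finset.sum_eq_zero fun a ha => hb a ha i hi
    obtain ⟨a, ha, hab⟩ := key
    refine ⟨a, fun i hi => ?_, hab⟩
    have h1 : X i * f ∈ I := (hmem _).1 (Ideal.subset_span ⟨i, hi, rfl⟩)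
    rw [hI, mem_ideal_span_monomial_image] at h1
    refine h1 _ ?_
    rw [mem_support_iff, add_comm, coeff_X_mul']
    simpa using ha
  · rintro ⟨a, ha, hab⟩
    refine ⟨Ideal.Quotient.mk I (monomial a 1), ?_⟩
    ext f
    rw [hcolon]
    constructor
    · intro hf
      rw [mem_ideal_span_X_image] at hf
      rw [hI, mem_ideal_span_monomial_image]
      intro m hm
      rw [mem_support_iff, coeff_mul_monomial'] at hm
      split_ifs at hm with ham
      · obtain ⟨i, hi, hne⟩ := hf (m - a) (by simpa using hm)
        obtain ⟨g, hg, hga⟩ := ha i hi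
        refine ⟨g, hg, hga.trans fun j => ?_⟩
        have h1 := ham j
        rw [Finsupp.tsub_apply] at hne
        rw [Finsupp.add_apply, Finsupp.single_apply]
        split_ifs with hij
        · subst hij; omega
        · omega
      · exact absurd rfl hm
    · intro hf
      rw [mem_ideal_span_X_image]
      by_contra! h
      obtain ⟨b, hb, hbP⟩ := h
      rw [hI, mem_ideal_span_monomial_image] at hf
      refine hab b hbP (hf _ ?_)
      rw [mem_support_iff, add_comm, coeff_mul_monomial]
      simpa using hb

end MonomialIdeal

/-! ### Families of independent sets -/

section Combinatorics

variable {V : Type*} (H : Hypergraph V)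

/-- There are `s` independent sets of `H` (sets containing no edge) such that each vertex `i` lies
in at least `c i` of them. -/
def HasIndepFamily (s : ℕ) (c : V → ℕ) : Prop :=
  ∃ C : Fin s → Set V, (∀ j, ∀ e ∈ H.edgeSet, ¬ e ⊆ C j) ∧ ∀ i, c i ≤ {j | i ∈ C j}.ncard

variable {H}

theorem HasIndepFamily.mono {s : ℕ} {c c' : V → ℕ} (h : H.HasIndepFamily s c)
    (hc : ∀ i, c' i ≤ c i) : H.HasIndepFamily s c' := by
  obtain ⟨C, hC, hcC⟩ := h
  exact ⟨C, hC, fun i => (hc i).trans (hcC i)⟩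

/-- Complementation turns the vertex covers whose product divides `x ^ a` into independent sets. -/
theorem hasIndepFamily_iff_exists_cover [Finite V] (hV : H.vertexSet = Set.univ) (s : ℕ)
    (a : V →₀ ℕ) :
    H.HasIndepFamily s (fun i => s - a i) ↔
      ∃ W : Fin s → Finset V, (∀ j, H.IsVertexCover (W j)) ∧
        ∑ j, ∑ i ∈ W j, Finsupp.single i 1 ≤ a := by
  classical
  have := Fintype.ofFinite V
  have hsum (W : Fin s → Finset V) (i : V) :
      (∑ j, ∑ i ∈ W j, Finsupp.single i 1 : V →₀ ℕ) i + {j | i ∉ W j}.ncard = s := by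
    have h1 : (∑ j, ∑ i ∈ W j, Finsupp.single i 1 : V →₀ ℕ) i = {j | i ∈ W j}.ncard := by
      rw [Set.ncard_eq_toFinset_card']
      simp [Finsupp.finsetSum_apply, Finsupp.single_apply]
    rw [h1]
    have h2 := Set.ncard_add_ncard_compl {j | i ∈ W j}
    rwa [Nat.card_fin] at h2
  constructor
  · rintro ⟨C, hC, hcC⟩
    refine ⟨fun j => (C j)ᶜ.toFinset, fun j => ⟨by simp [hV], fun e he => ?_⟩, fun i => ?_⟩
    · obtain ⟨x, hx, hxC⟩ := Set.not_subset.1 (hC j e he)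
      exact ⟨x, by simpa using hxC, hx⟩
    · have h1 := hsum (fun j => (C j)ᶜ.toFinset) i
      have h2 : s - a i ≤ {j | i ∈ C j}.ncard := hcC i
      simp only [Set.mem_toFinset, Set.mem_compl_iff, not_not] at h1 ⊢
      omega
  · rintro ⟨W, hW, hWa⟩
    refine ⟨fun j => (W j : Set V)ᶜ, fun j e he hsub => ?_, fun i => ?_⟩
    · obtain ⟨x, hxW, hx⟩ := (hW j).2 e he
      exact hsub hx hxW
    · have h1 := hsum W i
      have h2 := hWa i
      simp only [Set.mem_compl_iff, Finset.mem_coe]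
      omega

/-- A color class of the induced subhypergraph of the expansion on `T` contains at most one shadow
of each vertex, and projects to an independent set of `H`. Thus colorings are the same as families
of independent sets in which each vertex occurs as often as it has shadows in `T`. -/
theorem colorable_induce_expansion_iff (hV : H.vertexSet = Set.univ) {s : ℕ}
    (T : Set (V × Fin s)) :
    ((H.expansion s).induce T).Colorable s ↔
      H.HasIndepFamily s (fun i => {l | (i, l) ∈ T}.ncard) := by
  classical
  have hvert : ((H.expansion s).induce T).vertexSet = T := by
    ext p
    simp [induce, expansion, hV]
  constructor
  · rintro ⟨D, hU, hdisj, hD⟩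
    rw [hvert] at hU
    refine ⟨fun j => {i | ∃ l, (i, l) ∈ D j}, fun j e he hsub => ?_, fun i => ?_⟩
    · have hl (i : V) : ∃ l, i ∈ e → (i, l) ∈ D j := by
        by_cases hi : i ∈ e
        · exact (hsub hi).imp fun l hl _ => hl
        -- Any shadow will do here, and `j` shows that there is one.
        · exact ⟨j, fun h => absurd h hi⟩
      choose l hl using hl
      have hlD : (fun i => (i, l i)) '' e ⊆ D j := by
        rintro _ ⟨i, hi, rfl⟩
        exact hl i hi
      refine hD _ ⟨Or.inl ⟨e, he, l, rfl⟩, ?_⟩ j hlD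
      exact hlD.trans (hU ▸ Set.subset_iUnion D j)
    · have hcol (l : Fin s) : ∃ j, (i, l) ∈ T → (i, l) ∈ D j := by
        by_cases hl : (i, l) ∈ T
        · rw [← hU, Set.mem_iUnion] at hl
          exact hl.imp fun j hj _ => hj
        · exact ⟨l, fun h => absurd h hl⟩
      choose f hf using hcol
      refine Set.ncard_le_ncard_of_injOn f (fun l hl => ⟨l, hf l hl⟩) fun l hl k hk hlk => ?_
      by_contra hne
      refine hD {(i, l), (i, k)} ⟨Or.inr ⟨i, hV ▸ Set.mem_univ i, l, k, hne, rfl⟩, ?_⟩ (f l) ?_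
      · rintro p (rfl | rfl)
        exacts [hl, hk]
      · rintro p (rfl | rfl)
        exacts [hf l hl, hlk ▸ hf k hk]
  · rintro ⟨C, hC, hcC⟩
    have hinj (i : V) : ∃ f : Fin s → Fin s,
        (∀ l, (i, l) ∈ T → i ∈ C (f l)) ∧ Set.InjOn f {l | (i, l) ∈ T} := by
      rcases isEmpty_or_nonempty (Fin s) with h | h
      · exact ⟨id, fun l => isEmptyElim l, Set.injOn_id _⟩
      · obtain ⟨f, hf, hfi⟩ :=
          (Set.toFinite {l | (i, l) ∈ T}).exists_injOn_of_encard_le (t := {j | i ∈ C j}) (by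
            rw [← (Set.toFinite _).cast_ncard_eq, ← (Set.toFinite {j | i ∈ C j}).cast_ncard_eq]
            exact_mod_cast hcC i)
        exact ⟨f, hf, hfi⟩
    choose f hfC hfi using hinj
    refine ⟨fun j => {p | p ∈ T ∧ f p.1 p.2 = j}, ?_, ?_, ?_⟩
    · rw [hvert]
      ext p
      simp
    · intro j k hjk
      rw [Set.disjoint_left]
      rintro p ⟨-, rfl⟩ ⟨-, h⟩
      exact hjk h
    · rintro _ ⟨⟨e, he, l, rfl⟩ | ⟨i, -, l, k, hlk, rfl⟩, -⟩ j hsub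
      · refine hC j e he fun i hi => ?_
        obtain ⟨hT, rfl⟩ := hsub ⟨i, hi, rfl⟩
        exact hfC i (l i) hT
      · obtain ⟨hl, hlj⟩ := hsub (Or.inl rfl)
        obtain ⟨hk, hkj⟩ := hsub (Or.inr rfl)
        exact hlk (hfi i hl hk (hlj.trans hkj.symm))

end Combinatorics

/-! ### Critical hypergraphs -/

section Critical

variable {α : Type*} {G : Hypergraph α}

theorem Colorable.succ {d : ℕ} (h : G.Colorable d) (hne : ∀ e ∈ G.edgeSet, e.Nonempty) :
    G.Colorable (d + 1) := by
  obtain ⟨C, hU, hdisj, hC⟩ := h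
  refine ⟨Fin.cons ∅ C, ?_, ?_, ?_⟩
  · rw [← hU]
    ext x
    simp
  · intro i j hij
    cases i using Fin.cases with
    | zero => simp
    | succ i =>
      cases j using Fin.cases with
      | zero => simp
      | succ j => simpa using hdisj (fun h => hij (congrArg Fin.succ h))
  · intro e he i
    cases i using Fin.cases with
    | zero => simpa [Set.subset_empty_iff] using (hne e he).ne_empty
    | succ i => simpa using hC e he i

theorem Colorable.mono {d d' : ℕ} (h : G.Colorable d) (hne : ∀ e ∈ G.edgeSet, e.Nonempty)
    (hd : d ≤ d') : G.Colorable d' := by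
  induction hd with
  | refl => exact h
  | step _ ih => exact ih.succ hne

theorem chromaticNumber_le_iff_colorable {d : ℕ} (hne : ∀ e ∈ G.edgeSet, e.Nonempty) :
    G.chromaticNumber ≤ d ↔ G.Colorable d := by
  refine ⟨fun h => ?_, fun h => iInf₂_le d h⟩
  have h1 : G.chromaticNumber < (d + 1 : ℕ) :=
    h.trans_lt (by exact_mod_cast Nat.lt_succ_self d)
  rw [chromaticNumber] at h1
  simp only [iInf_lt_iff] at h1
  obtain ⟨n, hn, hlt⟩ := h1
  exact hn.mono hne (Nat.lt_succ_iff.1 (by exact_mod_cast hlt))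

theorem chromaticNumber_lt_succ_iff_colorable {d : ℕ} (hne : ∀ e ∈ G.edgeSet, e.Nonempty) :
    G.chromaticNumber < (d : ℕ∞) + 1 ↔ G.Colorable d := by
  rw [← chromaticNumber_le_iff_colorable hne, ENat.lt_add_one_iff (ENat.natCast_ne_top d)]

/-- A deleted vertex can be given a color of its own. -/
theorem Colorable.of_deleteVertex {d : ℕ} {x : α} (hx : x ∈ G.vertexSet)
    (hcard : ∀ e ∈ G.edgeSet, 2 ≤ e.encard) (h : (G.deleteVertex x).Colorable d) :
    G.Colorable (d + 1) := by
  obtain ⟨C, hU, hdisj, hC⟩ := h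
  have hxC (i) : x ∉ C i := fun hi => by
    have : x ∈ (G.deleteVertex x).vertexSet := hU ▸ Set.mem_iUnion_of_mem i hi
    exact this.2 rfl
  refine ⟨Fin.cons {x} C, ?_, ?_, ?_⟩
  · have h1 : (⋃ i, (Fin.cons {x} C : Fin (d + 1) → Set α) i) = {x} ∪ ⋃ i, C i := by
      ext y
      simp
    rw [h1, hU]
    exact Set.union_sdiff_cancel (Set.singleton_subset_iff.2 hx)
  · intro i j hij
    cases i using Fin.cases with
    | zero =>
      cases j using Fin.cases with
      | zero => exact absurd rfl hij
      | succ j => simpa using hxC j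
    | succ i =>
      cases j using Fin.cases with
      | zero => simpa using hxC i
      | succ j => simpa using hdisj (fun h => hij (congrArg Fin.succ h))
  · intro e he i hsub
    cases i using Fin.cases with
    | zero =>
      have h1 := (hcard e he).trans (Set.encard_le_encard hsub)
      simp at h1
    | succ i =>
      rw [Fin.cons_succ] at hsub
      exact hC e ⟨he, fun hxe => hxC i (hsub hxe)⟩ i hsub

/-- The vertex set is nonempty as soon as there is no `d`-coloring, so that the upper bound on the
chromatic number follows from the colorings of the vertex-deleted hypergraphs. -/
theorem isCriticallyChromatic_succ_iff {d : ℕ} (hcard : ∀ e ∈ G.edgeSet, 2 ≤ e.encard) :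
    G.IsCriticallyChromatic (d + 1) ↔
      ¬ G.Colorable d ∧ ∀ x ∈ G.vertexSet, (G.deleteVertex x).Colorable d := by
  have hne : ∀ e ∈ G.edgeSet, e.Nonempty := fun e he => by
    rw [← Set.encard_pos]
    exact lt_of_lt_of_le (by norm_num) (hcard e he)
  have hdel (x) : (G.deleteVertex x).chromaticNumber < (d : ℕ∞) + 1 ↔
      (G.deleteVertex x).Colorable d :=
    chromaticNumber_lt_succ_iff_colorable fun e he => hne e he.1
  rw [IsCriticallyChromatic, Nat.cast_add, Nat.cast_one]
  simp only [hdel]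
  refine and_congr_left fun hx => ?_
  rw [← chromaticNumber_lt_succ_iff_colorable hne, not_lt]
  refine ⟨fun h => h.ge, fun h => le_antisymm ?_ h⟩
  rcases G.vertexSet.eq_empty_or_nonempty with h0 | ⟨x, hxG⟩
  · have : G.Colorable d := by
      refine ⟨fun _ => ∅, by simp [h0], fun _ _ _ => by simp, fun e he _ hsub => ?_⟩
      exact (hne e he).ne_empty (Set.subset_empty_iff.1 hsub)
    exact absurd ((chromaticNumber_lt_succ_iff_colorable hne).2 this) h.not_gt
  · have := (chromaticNumber_le_iff_colorable hne).2 ((hx x hxG).of_deleteVertex hxG hcard)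
    exact_mod_cast this

theorem deleteVertex_induce (T : Set α) (x : α) :
    (G.induce T).deleteVertex x = G.induce (T \ {x}) := by
  ext e
  · simp [deleteVertex, induce, and_assoc]
  · simp [deleteVertex, induce, and_assoc, Set.subset_sdiff]

theorem two_le_encard_of_mem_edgeSet_expansion {H : Hypergraph α} (hH : H.IsSimple) {s : ℕ}
    {F : Set (α × Fin s)} (hF : F ∈ (H.expansion s).edgeSet) : 2 ≤ F.encard := by
  rcases hF with ⟨e, he, l, rfl⟩ | ⟨i, -, l, k, hlk, rfl⟩
  · rw [Function.Injective.encard_image fun i j hij => congrArg Prod.fst hij]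
    exact hH.1 e he
  · rw [Set.encard_pair fun h => hlk (congrArg Prod.snd h)]

/-- Criticality of an induced subhypergraph of the expansion, in terms of the numbers of shadows. -/
theorem isCriticallyChromatic_induce_expansion_iff {H : Hypergraph α} (hH : H.IsSimple)
    (hV : H.vertexSet = Set.univ) {s : ℕ} (T : Set (α × Fin s)) :
    ((H.expansion s).induce T).IsCriticallyChromatic (s + 1) ↔
      ¬ H.HasIndepFamily s (fun i => {l | (i, l) ∈ T}.ncard) ∧
        ∀ p ∈ T, H.HasIndepFamily s (fun i => {l | (i, l) ∈ T \ {p}}.ncard) := by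
  have hcard : ∀ e ∈ ((H.expansion s).induce T).edgeSet, 2 ≤ e.encard := fun e he =>
    two_le_encard_of_mem_edgeSet_expansion hH he.1
  rw [isCriticallyChromatic_succ_iff hcard]
  simp only [deleteVertex_induce, colorable_induce_expansion_iff hV]
  simp [induce, expansion, hV]

theorem ncard_shadows_sdiff_singleton {s : ℕ} {T : Set (α × Fin s)} {x : α} {l₀ : Fin s}
    (hp : (x, l₀) ∈ T) :
    {l | (x, l) ∈ T \ {(x, l₀)}}.ncard = {l | (x, l) ∈ T}.ncard - 1 := by
  rw [← Set.ncard_sdiff_singleton_of_mem (s := {l | (x, l) ∈ T}) hp]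
  congr 1
  ext l
  simp

theorem ncard_shadows_sdiff_singleton_of_ne {s : ℕ} {T : Set (α × Fin s)} {x y : α} {l₀ : Fin s}
    (hxy : y ≠ x) : {l | (y, l) ∈ T \ {(x, l₀)}}.ncard = {l | (y, l) ∈ T}.ncard := by
  congr 1
  ext l
  simp [hxy]

end Critical

/-! ### Powers of the cover ideal -/

section CoverIdeal

variable {V : Type*} {H : Hypergraph V}

theorem coverIdeal_eq_span_monomial (K : Type*) [Field K] (H : Hypergraph V) :
    H.coverIdeal K = Ideal.span ((fun a => monomial a (1 : K)) ''
      {a | ∃ W : Finset V, H.IsVertexCover W ∧ a = ∑ i ∈ W, Finsupp.single i 1}) := by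
  rw [coverIdeal]
  congr 1
  ext p
  constructor
  · rintro ⟨W, hW, rfl⟩
    exact ⟨_, ⟨W, hW, rfl⟩, monomial_sum_one _ _⟩
  · rintro ⟨_, ⟨W, hW, rfl⟩, rfl⟩
    exact ⟨W, hW, monomial_sum_one _ _⟩

/-- The associated primes of the powers of the cover ideal, in terms of families of independent
sets. -/
theorem span_X_image_mem_associatedPrimes_coverIdeal_pow_iff {K : Type*} [Field K] [Finite V]
    (hV : H.vertexSet = Set.univ) (s : ℕ) (P : Set V) :
    Ideal.span ((X : V → MvPolynomial V K) '' P) ∈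
        associatedPrimes (MvPolynomial V K) (MvPolynomial V K ⧸ (H.coverIdeal K) ^ s) ↔
      ∃ a : V →₀ ℕ,
        (∀ i ∈ P, H.HasIndepFamily s (fun j => s - (a + Finsupp.single i 1 : V →₀ ℕ) j)) ∧
        ∀ b : V →₀ ℕ, (∀ i ∈ P, b i = 0) → ¬ H.HasIndepFamily s (fun j => s - (a + b) j) := by
  have key (a : V →₀ ℕ) : (∃ g ∈ {a : V →₀ ℕ | ∃ f : Fin s → V →₀ ℕ,
      (∀ j, f j ∈ {a | ∃ W : Finset V,
      H.IsVertexCover W ∧ a = ∑ i ∈ W, Finsupp.single i 1}) ∧ a = ∑ j, f j}, g ≤ a) ↔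
      H.HasIndepFamily s (fun i => s - a i) := by
    rw [hasIndepFamily_iff_exists_cover hV]
    constructor
    · rintro ⟨_, ⟨f, hf, rfl⟩, hle⟩
      choose W hW hfW using hf
      exact ⟨W, hW, by simpa only [hfW] using hle⟩
    · rintro ⟨W, hW, hle⟩
      exact ⟨_, ⟨_, fun j => ⟨W j, hW j, rfl⟩, rfl⟩, hle⟩
  rw [coverIdeal_eq_span_monomial, span_monomial_pow, span_X_image_mem_associatedPrimes_iff]
  simp only [key]

end CoverIdeal

end Hypergraph

/-! ### Critical subhypergraphs and associated primes -/

open Hypergraph in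
theorem mainTheorem3 {K : Type*} [Field K] {V : Type*} [Finite V]
    (H : Hypergraph V) (hV : H.vertexSet = Set.univ) (hH : H.IsSimple)
    (s : ℕ) (hs : 1 ≤ s) (P : Set V) :
    Ideal.span ((MvPolynomial.X : V → MvPolynomial V K) '' P) ∈
        associatedPrimes (MvPolynomial V K) (MvPolynomial V K ⧸ (H.coverIdeal K) ^ s) ↔
      ∃ T : Set (V × Fin s),
        (∀ i ∈ P, (i, (⟨0, hs⟩ : Fin s)) ∈ T) ∧
        (∀ p ∈ T, p.1 ∈ P) ∧
        ((H.expansion s).induce T).IsCriticallyChromatic (s + 1) := by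
  classical
  rw [span_X_image_mem_associatedPrimes_coverIdeal_pow_iff hV]
  simp only [isCriticallyChromatic_induce_expansion_iff hH hV]
  constructor
  · rintro ⟨a, haP, hab⟩
    -- `T` has `s - a i` shadows of each `i ∈ P`, and none of the other vertices.
    let T : Set (V × Fin s) := {p | p.1 ∈ P ∧ (p.2 : ℕ) < s - a p.1}
    have hT (i : V) (hi : i ∈ P) : {l | (i, l) ∈ T}.ncard = s - a i := by
      have h1 : {l : Fin s | (i, l) ∈ T} =
          ((Finset.univ.filter fun l : Fin s => (l : ℕ) < s - a i : Finset (Fin s)) : Set (Fin s)) := by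
        ext l
        simp [T, hi]
      rw [h1, Set.ncard_coe_finset, Fin.card_filter_val_lt]
      omega
    have hT' (i : V) (hi : i ∉ P) : {l | (i, l) ∈ T}.ncard = 0 := by
      simp [T, hi]
    refine ⟨T, fun i hi => ⟨hi, ?_⟩, fun p hp => hp.1, ?_, ?_⟩
    · -- If `s ≤ a i`, then multiplying by the variable `i` makes no difference.
      by_contra h
      refine hab 0 (by simp) ((haP i hi).mono fun j => ?_)
      rw [Finsupp.add_apply, Finsupp.add_apply, Finsupp.single_apply, Finsupp.zero_apply]
      split_ifs with hij
      · subst hij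
        simp only at h
        omega
      · rfl
    · -- Raising all exponents outside `P` to at least `s` removes the vertices outside `P`.
      intro h
      refine hab (Finsupp.equivFunOnFinite.symm fun i => if i ∈ P then 0 else s)
        (fun i hi => by simp [hi]) (h.mono fun i => ?_)
      by_cases hi : i ∈ P
      · simp [hT i hi, hi]
      · simp [hi]
    · rintro ⟨x, l₀⟩ hp
      refine (haP x hp.1).mono fun i => ?_
      rcases eq_or_ne i x with rfl | hix
      · rw [ncard_shadows_sdiff_singleton hp, hT i hp.1]
        simp
        omega
      · rw [ncard_shadows_sdiff_singleton_of_ne hix]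
        by_cases hi : i ∈ P
        · simp [hT i hi, hix.symm]
        · simp [hT' i hi]
  · rintro ⟨T, hTP, hT, hnot, hdel⟩
    have hle (i : V) : {l | (i, l) ∈ T}.ncard ≤ s := by
      simpa using Set.ncard_le_card {l | (i, l) ∈ T}
    refine ⟨Finsupp.equivFunOnFinite.symm fun i => s - {l | (i, l) ∈ T}.ncard, ?_, ?_⟩
    · intro i hi
      refine (hdel _ (hTP i hi)).mono fun j => ?_
      have hj := hle j
      rcases eq_or_ne j i with rfl | hji
      · rw [ncard_shadows_sdiff_singleton (hTP j hi)]
        simp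
        omega
      · rw [ncard_shadows_sdiff_singleton_of_ne hji]
        simp [hji.symm]
        omega
    · intro b hb h
      refine hnot (h.mono fun i => ?_)
      have hi := hle i
      by_cases hiP : i ∈ P
      · simp [hb i hiP]
        omega
      · have h1 : {l | (i, l) ∈ T} = ∅ := by
          ext l
          simpa using fun h => hiP (hT _ h)
        simp [h1]
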